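/- Two ropes lie in the closed unit ball $B\subset\mathbb R^3$, viewed from above (the positive $z$-direction). A configuration of the ropes is a union of two disjoint embedded arcs in $B$ that meets $\partial B$ exactly in the four end points of the arcs, these being the corners $1,2,3,4$ (numbered counterclockwise from the bottom left) of a square inscribed in the equator. A tangle is a configuration up to ambient isotopy of $B$ fixing $\partial B$ pointwise. The untangle $\tau_0$ is the tangle of two uncrossed ropes, one joining corners $1$ and $4$, the other joining corners $2$ and $3$. Two moves act on tangles: the twist $T$ exchanges the ends in positions $1$ and $2$ by a half turn in which $1$ passes over $2$, and the turn $R$ rotates the ball by a quarter turn counterclockwise about the $z$-axis. Both moves are induced by homeomorphisms of $B$, so that the free group $\Gamma$ on the letters $R$ and $T$ acts on the set of tangles. A rational tangle is a tangle obtained from $\tau_0$ by a finite sequence of moves $T$ and $R$. Let $\Gamma$ also act on $\mathbb Q\cup\{\infty\}$, with $T$ acting by $x\mapsto x+1$ and $R$ by $x\mapsto -1/x$, where $\infty+1=\infty$, $-1/0=\infty$ and $-1/\infty=0$. A rational tangle has invariant $x$ if it is obtained from $\tau_0$ by some sequence of moves $T$ and $R$ that, performed on $\mathbb Q\cup\{\infty\}$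 starting from $0$, gives $x$. (It is not presupposed that the invariant depends only on the tangle.) **Proposition.** If a rational tangle has invariant $0$, then it is the untangle. Moreover, every $W\in\Gamma$ (a word in $R$, $T$ and their inverses) with $W\cdot 0=0$ in $\mathbb Q\cup\{\infty\}$ satisfies $W\cdot\tau_0=\tau_0$. -/

import Mathlib

open scoped unitInterval OnePoint

noncomputable section

namespace TangleTrick

/-! ### Tangles

The coordinates `p 0`, `p 1`, `p 2` of space are called `x`, `y`, `z`. The ropes are viewed from
above: `x` points to the right, `y` up the page, and `z` towards the viewer. -/

/-- Euclidean three-space. -/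
abbrev Space : Type := EuclideanSpace ℝ (Fin 3)

/-- The closed unit ball, in which the ropes live. -/
abbrev Ball : Type := Metric.closedBall (0 : Space) 1

/-- The bounding sphere of the ball. -/
def sphere : Set Ball := {p | ‖(p : Space)‖ = 1}

/-- The four positions at which the ends of the ropes are held: the corners
`1 = (-√2/2, -√2/2, 0)`, `2 = (√2/2, -√2/2, 0)`, `3 = (√2/2, √2/2, 0)`, `4 = (-√2/2, √2/2, 0)`
of a square inscribed in the equator, numbered counterclockwise from the bottom left. -/
def corners : Set Ball := {p | p.1 0 ^ 2 = 1 / 2 ∧ p.1 1 ^ 2 = 1 / 2 ∧ p.1 2 = 0}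

/-- A set is a tangle if it is the union of two disjoint arcs embedded in the ball, which meet the
bounding sphere exactly in their end points, these being the four corners. (An injective continuous
map from a compact space to a Hausdorff space is an embedding.) -/
def IsTangle (S : Set Ball) : Prop :=
  ∃ γ : Fin 2 × I → Ball, Continuous γ ∧ Function.Injective γ ∧ Set.range γ = S ∧
    (∀ q, γ q ∈ sphere ↔ q.2 = 0 ∨ q.2 = 1) ∧ (∀ q, γ q ∈ corners ↔ q.2 = 0 ∨ q.2 = 1)

/-- A configuration of the two ropes. -/
def RopeConfig : Type := {S : Set Ball // IsTangle S}

/-- Ambient isotopy of the ball, relative to the bounding sphere: one configuration is carried to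
the other by a continuous deformation of the ball through homeomorphisms, starting at the identity,
that never moves a point of the sphere. -/
def Isotopic (υ τ : RopeConfig) : Prop :=
  ∃ F : I → (Ball ≃ₜ Ball), Continuous (fun q : I × Ball => F q.1 q.2) ∧
    F 0 = Homeomorph.refl Ball ∧ (∀ t, ∀ p ∈ sphere, F t p = p) ∧ F 1 '' υ.1 = τ.1

theorem Isotopic.refl (υ : RopeConfig) : Isotopic υ υ :=
  ⟨fun _ => Homeomorph.refl Ball, continuous_snd, rfl, fun _ _ _ => rfl, by simp⟩

theorem Isotopic.symm {υ τ : RopeConfig} : Isotopic υ τ → Isotopic τ υ := by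
  rintro ⟨F, hF, h0, hs, h1⟩
  refine ⟨fun t => (F 1).symm.trans (F (unitInterval.symm t)), ?_, ?_, ?_, ?_⟩
  · exact hF.comp (((unitInterval.continuous_symm.comp continuous_fst)).prodMk
      ((F 1).symm.continuous.comp continuous_snd))
  · ext p : 1
    simp
  · intro t p hp
    have : (F 1).symm p = p := by rw [Homeomorph.symm_apply_eq, hs 1 p hp]
    simp [this, hs _ p hp]
  · rw [← h1, Set.image_image]
    simp only [unitInterval.symm_one, h0, Homeomorph.trans_apply, Homeomorph.symm_apply_apply,
      Homeomorph.refl_apply, id_eq, Set.image_id']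

theorem Isotopic.trans {ρ υ τ : RopeConfig} : Isotopic ρ υ → Isotopic υ τ → Isotopic ρ τ := by
  rintro ⟨F, hF, h0, hs, h1⟩ ⟨G, hG, k0, ks, k1⟩
  refine ⟨fun t => (F t).trans (G t), ?_, ?_, ?_, ?_⟩
  · exact hG.comp (continuous_fst.prodMk hF)
  · simp only [h0, k0]
    rfl
  · intro t p hp
    simp [hs t p hp, ks t p hp]
  · rw [← k1, ← h1, Set.image_image]
    rfl

instance isotopySetoid : Setoid RopeConfig :=
  ⟨Isotopic, Isotopic.refl, Isotopic.symm, Isotopic.trans⟩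

/-- A tangle: a configuration of the ropes, up to isotopy. -/
def Tangle : Type := Quotient isotopySetoid

/-! ### Moving the ends of the ropes -/

/-- The group of the homeomorphisms of the ball that preserve the bounding sphere and the set of
the four corners. -/
def Motion : Subgroup (Ball ≃ₜ Ball) where
  carrier := {h | ∀ p, (h p ∈ sphere ↔ p ∈ sphere) ∧ (h p ∈ corners ↔ p ∈ corners)}
  mul_mem' := by
    intro a b ha hb p
    exact ⟨(ha (b p)).1.trans (hb p).1, (ha (b p)).2.trans (hb p).2⟩
  one_mem' := fun _ => ⟨Iff.rfl, Iff.rfl⟩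
  inv_mem' := by
    intro a ha p
    have e : a (a⁻¹ p) = p := a.apply_symm_apply p
    have := ha (a⁻¹ p)
    rw [e] at this
    exact ⟨this.1.symm, this.2.symm⟩

theorem IsTangle.image {S : Set Ball} (hS : IsTangle S) (h : Motion) : IsTangle (h.1 '' S) := by
  obtain ⟨γ, c, i, r, s, m⟩ := hS
  refine ⟨fun q => h.1 (γ q), h.1.continuous.comp c, h.1.injective.comp i, ?_, ?_, ?_⟩
  · rw [← r, ← Set.range_comp]
    rfl
  · exact fun q => (h.2 (γ q)).1.trans (s q)
  · exact fun q => (h.2 (γ q)).2.trans (m q)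

/-- A motion carries a configuration of the ropes to its image. -/
instance : MulAction Motion RopeConfig where
  smul h υ := ⟨h.1 '' υ.1, υ.2.image h⟩
  one_smul _ := Subtype.ext (Set.image_id _)
  mul_smul g h υ := Subtype.ext (Set.image_comp g.1 h.1 υ.1)

theorem coe_smul (h : Motion) (υ : RopeConfig) : (h • υ).1 = h.1 '' υ.1 := rfl

theorem Isotopic.smul (h : Motion) {υ τ : RopeConfig} : Isotopic υ τ → Isotopic (h • υ) (h • τ) := by
  rintro ⟨F, hF, h0, hs, h1⟩
  refine ⟨fun t => (h.1.symm.trans (F t)).trans h.1, ?_, ?_, ?_, ?_⟩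
  · exact h.1.continuous.comp (hF.comp (continuous_fst.prodMk
      (h.1.symm.continuous.comp continuous_snd)))
  · ext p : 1
    simp [h0]
  · intro t p hp
    have : h.1.symm p ∈ sphere := ((h⁻¹).2 p).1.2 hp
    simp [hs t _ this]
  · rw [coe_smul, coe_smul, ← h1, Set.image_image, Set.image_image]
    simp only [Homeomorph.trans_apply, Homeomorph.symm_apply_apply]

/-- The induced action of the motions on tangles. -/
instance : MulAction Motion Tangle where
  smul h := Quotient.map (h • ·) fun _ _ => Isotopic.smul h
  one_smul τ := by
    induction τ using Quotient.inductionOn with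
    | h υ => exact congrArg (Quotient.mk _) (one_smul Motion υ)
  mul_smul g h τ := by
    induction τ using Quotient.inductionOn with
    | h υ => exact congrArg (Quotient.mk _) (mul_smul g h υ)

/-- A norm preserving homeomorphism of space restricts to the ball. -/
def restrictToBall (e : Space ≃ₜ Space) (he : ∀ p, ‖e p‖ = ‖p‖) : Ball ≃ₜ Ball :=
  e.subtype fun p => by simp [he]

/-- The angle of the twist at height `y`: it is `π` for `y ≤ -1/2`, it is `0` for `y ≥ 1/2`, and
it is linear in between. -/
def twistAngle (y : ℝ) : ℝ := Real.pi * max 0 (min 1 (1 / 2 - y))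

/-- The rotation of each slice `y = const` about the `y`-axis by the angle `φ y`, in the sense that
moves the points on the left over (`z > 0`) to the right. -/
def swirl (φ : ℝ → ℝ) (p : Space) : Space :=
  !₂[p 0 * Real.cos (φ (p 1)) + p 2 * Real.sin (φ (p 1)), p 1,
    p 2 * Real.cos (φ (p 1)) - p 0 * Real.sin (φ (p 1))]

theorem swirl_neg_swirl (φ : ℝ → ℝ) (p : Space) : swirl (fun y => -φ y) (swirl φ p) = p := by
  have h := Real.sin_sq_add_cos_sq (φ (p 1))
  ext i
  fin_cases i
  · simp [swirl]
    linear_combination p 0 * h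
  · simp [swirl]
  · simp [swirl]
    linear_combination p 2 * h

theorem continuous_swirl {φ : ℝ → ℝ} (hφ : Continuous φ) : Continuous (swirl φ) := by
  refine (PiLp.continuous_toLp 2 _).comp (continuous_pi fun i => ?_)
  fin_cases i <;> simp <;> fun_prop

theorem continuous_twistAngle : Continuous twistAngle := by
  unfold twistAngle
  fun_prop

/-- The twist of space: the part `y ≤ -1/2`, which contains the corners `1` and `2`, makes half a
turn about the `y`-axis, which exchanges these corners, with `1` passing over and `2` under; the
part `y ≥ 1/2`, which contains the corners `3` and `4`, is at rest. -/
def twistSpace : Space ≃ₜ Space where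
  toFun := swirl twistAngle
  invFun := swirl fun y => -twistAngle y
  left_inv := swirl_neg_swirl twistAngle
  right_inv p := by simpa using swirl_neg_swirl (fun y => -twistAngle y) p
  continuous_toFun := continuous_swirl continuous_twistAngle
  continuous_invFun := continuous_swirl continuous_twistAngle.neg

/-- The turn of space: the counterclockwise quarter turn `(x, y, z) ↦ (-y, x, z)`. -/
def turnSpace : Space ≃ₜ Space where
  toFun p := !₂[-p 1, p 0, p 2]
  invFun p := !₂[p 1, -p 0, p 2]
  left_inv p := by
    ext i
    fin_cases i <;> simp
  right_inv p := by
    ext i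
    fin_cases i <;> simp
  continuous_toFun := by
    refine (PiLp.continuous_toLp 2 _).comp (continuous_pi fun i => ?_)
    fin_cases i <;> simp <;> fun_prop
  continuous_invFun := by
    refine (PiLp.continuous_toLp 2 _).comp (continuous_pi fun i => ?_)
    fin_cases i <;> simp <;> fun_prop

theorem norm_twistSpace (p : Space) : ‖twistSpace p‖ = ‖p‖ := by
  have h := Real.sin_sq_add_cos_sq (twistAngle (p 1))
  rw [EuclideanSpace.norm_eq, EuclideanSpace.norm_eq]
  congr 1
  simp [twistSpace, swirl, Fin.sum_univ_three]
  linear_combination (p 0 ^ 2 + p 2 ^ 2) * h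

theorem norm_turnSpace (p : Space) : ‖turnSpace p‖ = ‖p‖ := by
  rw [EuclideanSpace.norm_eq, EuclideanSpace.norm_eq]
  congr 1
  simp [turnSpace, Fin.sum_univ_three]
  ring

theorem twistAngle_eq {y : ℝ} (hy : y ^ 2 = 1 / 2) : Real.sin (twistAngle y) = 0 := by
  rcases le_total 0 y with h | h
  · have : 1 / 2 - y ≤ 0 := by nlinarith
    rw [twistAngle, min_eq_right (this.trans zero_le_one), max_eq_left this, mul_zero, Real.sin_zero]
  · have : 1 ≤ 1 / 2 - y := by nlinarith
    rw [twistAngle, min_eq_left this, max_eq_right zero_le_one, mul_one, Real.sin_pi]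

/-- The move **T**: the ends in positions `1` and `2` are exchanged, `1` passing over `2`. -/
def twist : Motion where
  val := restrictToBall twistSpace norm_twistSpace
  property p := by
    refine ⟨iff_of_eq (congrArg (· = 1) (norm_twistSpace p.1)), ?_⟩
    change (twistSpace p.1 0 ^ 2 = 1 / 2 ∧ twistSpace p.1 1 ^ 2 = 1 / 2 ∧ twistSpace p.1 2 = 0) ↔
      (p.1 0 ^ 2 = 1 / 2 ∧ p.1 1 ^ 2 = 1 / 2 ∧ p.1 2 = 0)
    have e0 : twistSpace p.1 0 = p.1 0 * Real.cos (twistAngle (p.1 1))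
      + p.1 2 * Real.sin (twistAngle (p.1 1)) := rfl
    have e1 : twistSpace p.1 1 = p.1 1 := rfl
    have e2 : twistSpace p.1 2 = p.1 2 * Real.cos (twistAngle (p.1 1))
      - p.1 0 * Real.sin (twistAngle (p.1 1)) := rfl
    rw [e0, e1, e2]
    by_cases h : p.1 1 ^ 2 = 1 / 2
    · have hs := twistAngle_eq h
      have hc : Real.cos (twistAngle (p.1 1)) ^ 2 = 1 := by
        have := Real.sin_sq_add_cos_sq (twistAngle (p.1 1))
        rw [hs] at this
        linarith
      have hc0 : Real.cos (twistAngle (p.1 1)) ≠ 0 := by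
        intro h0
        simp [h0] at hc
      simp [hs, h, mul_pow, hc, hc0]
    · exact iff_of_false (fun k => h k.2.1) (fun k => h k.2.1)

/-- The move **R**: the four ends are rotated one position counterclockwise. -/
def turn : Motion where
  val := restrictToBall turnSpace norm_turnSpace
  property p := by
    refine ⟨iff_of_eq (congrArg (· = 1) (norm_turnSpace p.1)), ?_⟩
    change (turnSpace p.1 0 ^ 2 = 1 / 2 ∧ turnSpace p.1 1 ^ 2 = 1 / 2 ∧ turnSpace p.1 2 = 0) ↔
      (p.1 0 ^ 2 = 1 / 2 ∧ p.1 1 ^ 2 = 1 / 2 ∧ p.1 2 = 0)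
    have e0 : turnSpace p.1 0 = -p.1 1 := rfl
    have e1 : turnSpace p.1 1 = p.1 0 := rfl
    have e2 : turnSpace p.1 2 = p.1 2 := rfl
    rw [e0, e1, e2, neg_sq]
    tauto

/-! ### The untangle -/

/-- The two uncrossed ropes `)(`: the curves `x = ±max(1/2, |y|)` in the plane `z = 0`, one joining
the corners `1` and `4` on the left, the other joining the corners `2` and `3` on the right. -/
def untangleSet : Set Ball := {p | |p.1 0| = max (1 / 2) |p.1 1| ∧ p.1 2 = 0}

/-- A parametrization of the two uncrossed ropes by the height `y ∈ [-√2/2, √2/2]`. -/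
def untanglePath (q : Fin 2 × I) : Space :=
  !₂[(if q.1 = 0 then -1 else 1) * max (1 / 2) |√2 / 2 * (2 * (q.2 : ℝ) - 1)|,
    √2 / 2 * (2 * (q.2 : ℝ) - 1), 0]

theorem norm_eq_of_zero {p : Space} (h2 : p 2 = 0) : ‖p‖ ^ 2 = p 0 ^ 2 + p 1 ^ 2 := by
  rw [EuclideanSpace.norm_sq_eq, Fin.sum_univ_three]
  simp [h2]

theorem sq_max_add_sq_le_iff (y : ℝ) : max (1 / 2) |y| ^ 2 + y ^ 2 ≤ 1 ↔ y ^ 2 ≤ 1 / 2 := by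
  have h := sq_abs y
  have h0 := abs_nonneg y
  rcases le_total (1 / 2) |y| with h1 | h1
  · rw [max_eq_right h1, h]
    constructor <;> intro <;> linarith
  · rw [max_eq_left h1]
    constructor <;> intro <;> nlinarith

theorem sq_max_add_sq_eq_iff (y : ℝ) : max (1 / 2) |y| ^ 2 + y ^ 2 = 1 ↔ y ^ 2 = 1 / 2 := by
  have h := sq_abs y
  have h0 := abs_nonneg y
  rcases le_total (1 / 2) |y| with h1 | h1
  · rw [max_eq_right h1, h]
    constructor <;> intro <;> linarith
  · rw [max_eq_left h1]
    constructor <;> intro <;> nlinarith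

theorem sq_max_eq_iff (y : ℝ) (hy : y ^ 2 = 1 / 2) : max (1 / 2) |y| ^ 2 = 1 / 2 := by
  have := (sq_max_add_sq_eq_iff y).2 hy
  linarith

theorem untanglePath_zero_sq (q : Fin 2 × I) :
    untanglePath q 0 ^ 2 = max (1 / 2) |untanglePath q 1| ^ 2 := by
  simp only [untanglePath]
  by_cases h : q.1 = 0 <;> simp [h]

theorem untanglePath_one_sq (q : Fin 2 × I) :
    untanglePath q 1 ^ 2 = 1 / 2 * (2 * (q.2 : ℝ) - 1) ^ 2 := by
  have h : (√2 : ℝ) ^ 2 = 2 := Real.sq_sqrt (by norm_num)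
  have : untanglePath q 1 = √2 / 2 * (2 * (q.2 : ℝ) - 1) := rfl
  rw [this]
  linear_combination (2 * (q.2 : ℝ) - 1) ^ 2 / 4 * h

theorem untanglePath_one_sq_eq (q : Fin 2 × I) :
    untanglePath q 1 ^ 2 = 1 / 2 ↔ q.2 = 0 ∨ q.2 = 1 := by
  rw [untanglePath_one_sq, Subtype.ext_iff, Subtype.ext_iff, Set.Icc.coe_zero, Set.Icc.coe_one]
  constructor
  · intro h
    have : (q.2 : ℝ) * ((q.2 : ℝ) - 1) = 0 := by linarith
    rcases mul_eq_zero.1 this with h | h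
    · exact Or.inl h
    · exact Or.inr (by linarith)
  · rintro (h | h) <;> rw [h] <;> norm_num

theorem untanglePath_mem (q : Fin 2 × I) : untanglePath q ∈ Metric.closedBall (0 : Space) 1 := by
  have h : ‖untanglePath q‖ ^ 2 ≤ 1 := by
    rw [norm_eq_of_zero (by rfl), untanglePath_zero_sq, sq_max_add_sq_le_iff, untanglePath_one_sq]
    nlinarith [q.2.2.1, q.2.2.2]
  rw [mem_closedBall_zero_iff]
  nlinarith [norm_nonneg (untanglePath q)]

theorem isTangle_untangleSet : IsTangle untangleSet := by
  have hs : (√2 : ℝ) ^ 2 = 2 := Real.sq_sqrt (by norm_num)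
  have hp : (0 : ℝ) < √2 := by positivity
  refine ⟨fun q => ⟨untanglePath q, untanglePath_mem q⟩, ?_, ?_, ?_, ?_, ?_⟩
  · refine Continuous.subtype_mk ((PiLp.continuous_toLp 2 _).comp (continuous_pi fun i => ?_)) _
    have h0 : Continuous fun q : Fin 2 × I => (if q.1 = 0 then (-1 : ℝ) else 1) :=
      (continuous_of_discreteTopology (f := fun i : Fin 2 => if i = 0 then (-1 : ℝ) else 1)).comp
        continuous_fst
    fin_cases i
    · exact h0.mul (by fun_prop)
    · change Continuous fun q : Fin 2 × I => √2 / 2 * (2 * (q.2 : ℝ) - 1)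
      fun_prop
    · exact continuous_const
  · rintro ⟨i, s⟩ ⟨j, t⟩ h
    have h := congrArg Subtype.val h
    have h1 : √2 / 2 * (2 * (s : ℝ) - 1) = √2 / 2 * (2 * (t : ℝ) - 1) :=
      congrArg (fun p : Space => p 1) h
    have hst : s = t := by
      have := mul_left_cancel₀ (by positivity) h1
      exact Subtype.ext (by linarith)
    subst hst
    have h0 : (if i = 0 then (-1 : ℝ) else 1) * max (1 / 2) |√2 / 2 * (2 * (s : ℝ) - 1)|
        = (if j = 0 then (-1 : ℝ) else 1) * max (1 / 2) |√2 / 2 * (2 * (s : ℝ) - 1)| :=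
      congrArg (fun p : Space => p 0) h
    have hm : max (1 / 2) |√2 / 2 * (2 * (s : ℝ) - 1)| ≠ 0 :=
      (lt_of_lt_of_le (by norm_num) (le_max_left _ _)).ne'
    have h0 := mul_right_cancel₀ hm h0
    fin_cases i <;> fin_cases j <;> simp at h0 ⊢ <;> norm_num at h0
  · ext p
    constructor
    · rintro ⟨q, rfl⟩
      refine ⟨?_, rfl⟩
      rw [← sq_eq_sq₀ (abs_nonneg _) (le_max_of_le_left (by norm_num)), sq_abs]
      exact untanglePath_zero_sq q
    · rintro ⟨h0, h2⟩
      have hb : p.1 1 ^ 2 ≤ 1 / 2 := by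
        rw [← sq_max_add_sq_le_iff, ← h0, sq_abs, ← norm_eq_of_zero h2]
        have := mem_closedBall_zero_iff.1 p.2
        nlinarith [norm_nonneg p.1]
      have hy : |√2 * p.1 1| ≤ 1 := by
        rw [← sq_le_one_iff_abs_le_one, mul_pow, hs]
        linarith
      rw [abs_le] at hy
      have e : √2 / 2 * (2 * ((√2 * p.1 1 + 1) / 2) - 1) = p.1 1 := by
        linear_combination p.1 1 / 2 * hs
      refine ⟨⟨if p.1 0 < 0 then 0 else 1, ⟨(√2 * p.1 1 + 1) / 2, ?_, ?_⟩⟩, ?_⟩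
      · linarith
      · linarith
      · apply Subtype.ext
        ext i
        fin_cases i
        · simp only [untanglePath, e, ← h0]
          by_cases hn : p.1 0 < 0
          · simp [hn, abs_of_neg hn]
          · simp [hn, abs_of_nonneg (not_lt.1 hn)]
        · exact e
        · exact h2.symm
  · intro q
    rw [← untanglePath_one_sq_eq, ← sq_max_add_sq_eq_iff, ← untanglePath_zero_sq,
      ← norm_eq_of_zero (by rfl)]
    exact (pow_eq_one_iff_of_nonneg (norm_nonneg _) (by norm_num)).symm
  · intro q
    rw [← untanglePath_one_sq_eq]
    refine ⟨fun h => h.2.1, fun h => ⟨?_, h, rfl⟩⟩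
    have := untanglePath_zero_sq q
    rw [sq_max_eq_iff _ h] at this
    exact this

/-- The two uncrossed ropes, as a configuration. -/
def untangleConfig : RopeConfig := ⟨untangleSet, isTangle_untangleSet⟩

/-- The untangle: the initial state of the ropes. -/
def untangle : Tangle := Quotient.mk _ untangleConfig

/-! ### Moves, rational tangles and their invariants -/

/-- The letters for the two moves. -/
inductive Move : Type
  | T
  | R

/-- The motion of the ball that performs a move. -/
def Move.motion : Move → Motion
  | T => twist
  | R => turn

/-- The rule `x ↦ x + 1` on `ℚ ∪ {∞}`, with `∞ + 1 = ∞`. -/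
def addOne : OnePoint ℚ → OnePoint ℚ
  | ∞ => ∞
  | (x : ℚ) => ((x + 1 : ℚ) : OnePoint ℚ)

/-- The rule `x ↦ x - 1` on `ℚ ∪ {∞}`, the inverse of `addOne`. -/
def subOne : OnePoint ℚ → OnePoint ℚ
  | ∞ => ∞
  | (x : ℚ) => ((x - 1 : ℚ) : OnePoint ℚ)

/-- The rule `x ↦ -1/x` on `ℚ ∪ {∞}`, with `-1/0 = ∞` and `-1/∞ = 0`. -/
def negInv : OnePoint ℚ → OnePoint ℚ
  | ∞ => ((0 : ℚ) : OnePoint ℚ)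
  | (x : ℚ) => if x = 0 then ∞ else ((-1 / x : ℚ) : OnePoint ℚ)

theorem negInv_negInv (x : OnePoint ℚ) : negInv (negInv x) = x := by
  induction x using OnePoint.rec with
  | infty => simp [negInv]
  | coe x =>
    by_cases h : x = 0
    · simp [negInv, h]
    · simp [negInv, h]

/-- The effect of a move on the invariant: `T` acts by `x ↦ x + 1` and `R` by `x ↦ -1/x`. -/
def Move.value : Move → Equiv.Perm (OnePoint ℚ)
  | T =>
    { toFun := addOne
      invFun := subOne
      left_inv := fun x => by
        induction x using OnePoint.rec with
        | infty => rfl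
        | coe x => simp [addOne, subOne]
      right_inv := fun x => by
        induction x using OnePoint.rec with
        | infty => rfl
        | coe x => simp [addOne, subOne] }
  | R => ⟨negInv, negInv, negInv_negInv, negInv_negInv⟩

/-- The tangle that results from the untangle by a sequence of moves. The word acts from the left:
its last letter is the first move performed. -/
def perform : List Move → Tangle
  | [] => untangle
  | m :: w => m.motion • perform w

/-- The invariant of a sequence of moves: it is `0` for the empty sequence, and changes with each
move according to the rules. -/
def invariant : List Move → OnePoint ℚ
  | [] => ((0 : ℚ) : OnePoint ℚ)
  | m :: w => m.value (invariant w)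

/-- A rational tangle: one that is obtained from the untangle by a sequence of moves. -/
def RationalTangle : Type := {τ : Tangle // ∃ w : List Move, perform w = τ}

/-- The rational tangle `τ` has invariant `x` if some sequence of moves that leads from the untangle
to `τ` has invariant `x`. -/
def RationalTangle.HasInvariant (τ : RationalTangle) (x : OnePoint ℚ) : Prop :=
  ∃ w : List Move, perform w = τ.1 ∧ invariant w = x

/-- The action of the free group on the letters `T` and `R` on tangles. -/
def tangleAction : FreeGroup Move →* Motion := FreeGroup.lift Move.motion

/-- The action of the free group on the letters `T` and `R` on `ℚ ∪ {∞}`. -/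
def valueAction : FreeGroup Move →* Equiv.Perm (OnePoint ℚ) := FreeGroup.lift Move.value

end TangleTrick

end

/-!
The values of `T` and `R` generate the modular group `⟨T, R | R² = (R T)³ = 1⟩`, in which the
stabilizer of `0` is generated by the conjugate `R T R⁻¹`. So the proposition follows once `T` is
known to fix `R • untangle`, and `R²` and `(R T)³` to act trivially on the orbit of the untangle
under the group `Γ` generated by the moves; instead of the presentation of the modular group, the
Euclidean algorithm is used, which attaches to each element of `ℚ ∪ {∞}` an element of this orbit,
equivariantly (`exists_equivariant`).

The twist preserves the turned ropes as a set (`twist_turn_untangle`). The square of the turn is the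
half turn about the `z`-axis; the half turns about the three axes form a group that is normalized by
the turn and by the twist and fixes the untangle, hence its whole orbit
(`flipInvariant_tangleAction`).

For `(R T)³`, by the Alexander trick the action of a homeomorphism of the ball on tangles depends
only on its restriction to the sphere (`smul_eq_smul_of_eqOn_sphere`). Therefore a motion whose
restriction to the sphere is isotopic to the identity relative to the four corners fixes the untangle:
the isotopy can be performed in a collar in which the ropes are radial
(`IsotopicToOne.smul_untangle`). As these motions are closed under conjugation, they act trivially on the
orbit. It remains to deform `(R T)³` to the identity relative to the corners. `R T` fixes the corner
`2` and permutes the others cyclically. After half a twist the corners are the vertices of a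
tetrahedron, and `R T` becomes isotopic to the linear map of order three that permutes the vertices
in the same way. The path `tetraHomeo` realizes this isotopy: while the twist is distributed over the
time before and after the turn, the turn is deformed through the linear maps `tetra t` that are
forced by the motion of the corners.
-/

noncomputable section

namespace TangleTrick

/-! ### The Euclidean algorithm in an action of the modular group -/

section Euclid

variable {X : Type*} (T R : Equiv.Perm X) (x₀ : X)

/-- The element of `X` attached to the rational number `x` by its continued fraction:
`T ^ ⌊x⌋ • x₀` if `x` is an integer, and `T ^ ⌊x⌋ • R • y` with `y` the element attached to
`-1 / fract x` otherwise. The recursion ends because the denominators decrease. -/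
def euclid (x : ℚ) : X :=
  (T ^ ⌊x⌋) (if Int.fract x = 0 then x₀ else R (euclid (-(Int.fract x)⁻¹)))
termination_by x.den
decreasing_by
  rename_i h
  have h0 : 0 < Int.fract x := lt_of_le_of_ne (Int.fract_nonneg x) (Ne.symm h)
  have h1 : (Int.fract x).num < (Int.fract x).den :=
    Rat.num_lt_denom_iff.2 (Int.fract_lt_one x)
  have h2 : 0 < (Int.fract x).num := Rat.num_pos.2 h0
  rw [Rat.neg_den, Rat.den_inv_of_ne_zero h, ← Rat.den_intFract x]
  omega

theorem euclid_zero : euclid T R x₀ 0 = x₀ := by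
  rw [euclid]
  simp

theorem euclid_add_one (x : ℚ) : euclid T R x₀ (x + 1) = T (euclid T R x₀ x) := by
  rw [euclid, euclid.eq_1 T R x₀ x, Int.floor_add_one, Int.fract_add_one, add_comm, zpow_one_add]
  rfl

variable {T R x₀}

theorem euclid_of_lt_one (hR : ∀ x, R (R x) = x) {x : ℚ} (h0 : 0 < x) (h1 : x < 1) :
    R (euclid T R x₀ x) = euclid T R x₀ (-x⁻¹) := by
  rw [euclid, Int.floor_eq_zero_iff.2 ⟨h0.le, h1⟩, Int.fract_eq_self.2 ⟨h0.le, h1⟩, if_neg h0.ne',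
    zpow_zero, Equiv.Perm.one_apply, hR]

theorem euclid_of_pos (hR : ∀ x, R (R x) = x) (hRT : ∀ x, R (T (R (T (R (T x))))) = x)
    (h0 : T (R x₀) = R x₀) (n : ℕ) {x : ℚ} (hx : 0 < x) (hn : x ≤ n + 1) :
    R (euclid T R x₀ x) = euclid T R x₀ (-x⁻¹) := by
  induction n generalizing x with
  | zero =>
    rcases lt_or_eq_of_le hn with h | rfl
    · exact euclid_of_lt_one hR hx (by simpa using h)
    · apply T.injective
      rw [← euclid_add_one]
      have e := hRT (R x₀)
      rw [h0, hR] at e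
      have e1 := euclid_add_one T R x₀ 0
      rw [zero_add, euclid_zero] at e1
      simp [euclid_zero, e1, R.injective e]
  | succ n ih =>
    rcases le_or_gt x 1 with h | h
    · exact ih hx (by
        have : (0 : ℚ) ≤ n := n.cast_nonneg
        linarith)
    -- With `y = x - 1`, the claim for `y` gives the claim for `x` by the relation `(R T)³ = 1`.
    obtain ⟨y, rfl⟩ : ∃ y, x = y + 1 := ⟨x - 1, by ring⟩
    have hy : 0 < y := by linarith
    have i := ih hy (by push_cast at hn; linarith)
    have e1 : -y⁻¹ = -(y / (y + 1))⁻¹ + 1 := by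
      field_simp
      ring
    have e2 : -(y + 1)⁻¹ + 1 = y / (y + 1) := by
      field_simp
      ring
    rw [e1, euclid_add_one] at i
    have e3 := hRT (euclid T R x₀ (-(y / (y + 1))⁻¹))
    rw [← i, hR, ← euclid_of_lt_one hR (by positivity) (by rw [div_lt_one hx]; linarith)] at e3
    apply T.injective
    rw [← euclid_add_one, e2, euclid_add_one]
    exact R.injective e3

theorem euclid_neg_inv (hR : ∀ x, R (R x) = x) (hRT : ∀ x, R (T (R (T (R (T x))))) = x)
    (h0 : T (R x₀) = R x₀) {x : ℚ} (hx : x ≠ 0) :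
    R (euclid T R x₀ x) = euclid T R x₀ (-x⁻¹) := by
  have key {x : ℚ} (hx : 0 < x) : R (euclid T R x₀ x) = euclid T R x₀ (-x⁻¹) := by
    obtain ⟨n, hn⟩ := exists_nat_ge x
    exact euclid_of_pos hR hRT h0 n hx (by linarith)
  rcases lt_or_gt_of_ne hx with h | h
  · have := key (x := -x⁻¹) (by simpa using h)
    rw [inv_neg, inv_inv, neg_neg] at this
    rw [← this, hR]
  · exact key h

/-- If `R² = 1` and `(R T)³ = 1` in an action on `X`, and `T` fixes `R x₀`, then `x₀` is the image
of `0` under an equivariant map from `ℚ ∪ {∞}` to `X`. In other words, these relations imply all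
relations `W • x₀ = x₀` with `W • 0 = 0`. -/
theorem exists_equivariant (hR : ∀ x, R (R x) = x) (hRT : ∀ x, R (T (R (T (R (T x))))) = x)
    (h0 : T (R x₀) = R x₀) :
    ∃ c : OnePoint ℚ → X, c ((0 : ℚ) : OnePoint ℚ) = x₀ ∧
      (∀ x, c (Move.T.value x) = T (c x)) ∧ ∀ x, c (Move.R.value x) = R (c x) := by
  refine ⟨fun x => x.elim (R x₀) (euclid T R x₀), euclid_zero T R x₀, fun x => ?_,
    fun x => ?_⟩
  · induction x using OnePoint.rec with
    | infty => exact h0.symm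
    | coe x => exact euclid_add_one T R x₀ x
  · induction x using OnePoint.rec with
    | infty => exact (euclid_zero T R x₀).trans (hR x₀).symm
    | coe x =>
      change (negInv (x : OnePoint ℚ)).elim (R x₀) (euclid T R x₀) = R (euclid T R x₀ x)
      by_cases h : x = 0
      · simp only [negInv, h, if_true, euclid_zero]
        rfl
      · rw [euclid_neg_inv hR hRT h0 h, inv_eq_one_div, ← neg_div]
        simp only [negInv, if_neg h]
        rfl

end Euclid

/-! ### The Alexander trick -/

/-- The retraction of space onto the ball. -/
def clip (x : Space) : Ball :=
  ⟨(max 1 ‖x‖)⁻¹ • x, by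
    have h : 0 < max 1 ‖x‖ := lt_max_of_lt_left one_pos
    rw [mem_closedBall_zero_iff, norm_smul, norm_inv, Real.norm_of_nonneg h.le,
      inv_mul_le_one₀ h]
    exact le_max_right _ _⟩

theorem continuous_clip : Continuous clip := by
  have h : Continuous fun x : Space => max 1 ‖x‖ := by fun_prop
  refine ((h.inv₀ fun x => ?_).smul continuous_id).subtype_mk _
  exact (lt_max_of_lt_left one_pos).ne'

theorem clip_coe (q : Ball) : clip q = q := by
  have : ‖(q : Space)‖ ≤ 1 := mem_closedBall_zero_iff.1 q.2
  exact Subtype.ext (by simp [clip, max_eq_left this])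

theorem clip_mem_sphere {x : Space} (hx : 1 ≤ ‖x‖) : clip x ∈ sphere := by
  change ‖(max 1 ‖x‖)⁻¹ • x‖ = 1
  rw [max_eq_right hx, norm_smul, norm_inv, norm_norm, inv_mul_cancel₀ (by linarith)]

/-- The homeomorphism `k` of the ball, transported to the ball of radius `t` and extended by the
identity. For `t = 0` this is the identity, whatever the value of `0⁻¹`. -/
def alexander (k : Ball ≃ₜ Ball) (t : ℝ) (p : Space) : Space :=
  p + t • ((k (clip (t⁻¹ • p)) : Space) - clip (t⁻¹ • p))

theorem alexander_smul (k : Ball ≃ₜ Ball) {t : ℝ} (ht : 0 < t) (q : Ball) :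
    alexander k t (t • (q : Space)) = t • (k q : Space) := by
  rw [alexander, inv_smul_smul₀ ht.ne', clip_coe, smul_sub, add_sub_cancel]

theorem alexander_of_le {k : Ball ≃ₜ Ball} (hk : ∀ p ∈ sphere, k p = p) {t : ℝ} (ht : 0 ≤ t)
    {p : Space} (hp : t ≤ ‖p‖) : alexander k t p = p := by
  rcases ht.eq_or_lt with rfl | ht
  · simp [alexander]
  · rw [alexander, hk _ (clip_mem_sphere _), sub_self, smul_zero, add_zero]
    rwa [norm_smul, norm_inv, Real.norm_of_nonneg ht.le, le_inv_mul_iff₀ ht, mul_one]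

theorem exists_eq_smul {t : ℝ} {p : Space} (hp : ‖p‖ < t) :
    0 < t ∧ ∃ q : Ball, p = t • (q : Space) := by
  have ht : 0 < t := (norm_nonneg p).trans_lt hp
  refine ⟨ht, ⟨t⁻¹ • p, ?_⟩, (smul_inv_smul₀ ht.ne' p).symm⟩
  rw [mem_closedBall_zero_iff, norm_smul, norm_inv, Real.norm_of_nonneg ht.le,
    inv_mul_le_iff₀ ht, mul_one]
  exact hp.le

theorem alexander_alexander {k l : Ball ≃ₜ Ball} (hk : ∀ p ∈ sphere, k p = p)
    (hl : ∀ p ∈ sphere, l p = p) (hlk : ∀ p, l (k p) = p) {t : ℝ} (ht : 0 ≤ t) (p : Space) :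
    alexander l t (alexander k t p) = p := by
  rcases le_or_gt t ‖p‖ with h | h
  · rw [alexander_of_le hk ht h, alexander_of_le hl ht h]
  · obtain ⟨ht, q, rfl⟩ := exists_eq_smul h
    rw [alexander_smul k ht, alexander_smul l ht, hlk]

theorem norm_alexander_le {k : Ball ≃ₜ Ball} (hk : ∀ p ∈ sphere, k p = p) {t : ℝ} (ht : 0 ≤ t)
    (ht1 : t ≤ 1) {p : Space} (hp : ‖p‖ ≤ 1) : ‖alexander k t p‖ ≤ 1 := by
  rcases le_or_gt t ‖p‖ with h | h
  · rwa [alexander_of_le hk ht h]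
  · obtain ⟨ht, q, rfl⟩ := exists_eq_smul h
    rw [alexander_smul k ht, norm_smul, Real.norm_of_nonneg ht.le]
    exact mul_le_one₀ ht1 (norm_nonneg _) (mem_closedBall_zero_iff.1 (k q).2)

theorem continuous_alexander (k : Ball ≃ₜ Ball) :
    Continuous fun q : ℝ × Space => alexander k q.1 q.2 := by
  refine continuous_snd.add (continuous_iff_continuousAt.2 fun ⟨t, p⟩ => ?_)
  have hc : Continuous fun x : Space => ((k (clip x) : Space) - clip x) :=
    (continuous_subtype_val.comp (k.continuous.comp continuous_clip)).sub
      (continuous_subtype_val.comp continuous_clip)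
  by_cases ht : t = 0
  · -- The displacement at time `t` is at most `2 |t|`.
    subst ht
    have hb (x : Space) : ‖(k (clip x) : Space) - clip x‖ ≤ 2 :=
      (norm_sub_le _ _).trans (by
        linarith [mem_closedBall_zero_iff.1 (k (clip x)).2, mem_closedBall_zero_iff.1 (clip x).2])
    rw [ContinuousAt, zero_smul]
    refine squeeze_zero_norm (a := fun q : ℝ × Space => ‖q.1‖ * 2) (fun q => ?_) ?_
    · rw [norm_smul]
      exact mul_le_mul_of_nonneg_left (hb _) (norm_nonneg _)
    · have : Continuous fun q : ℝ × Space => ‖q.1‖ * 2 := by fun_prop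
      simpa using this.tendsto (0, p)
  · have h1 : ContinuousAt (fun q : ℝ × Space => q.1⁻¹ • q.2) (t, p) :=
      (continuousAt_fst.inv₀ ht).smul continuousAt_snd
    exact continuousAt_fst.smul (hc.continuousAt.comp h1)

/-- The Alexander trick: a motion that is the identity on the sphere moves every configuration of
the ropes to an isotopic one. -/
theorem isotopic_smul_of_eqOn_sphere (k : Motion) (hk : ∀ p ∈ sphere, k.1 p = p) (υ : RopeConfig) :
    Isotopic υ (k • υ) := by
  have hk' : ∀ p ∈ sphere, k.1.symm p = p := fun p hp => by
    rw [Homeomorph.symm_apply_eq, hk p hp]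
  have hc (l : Ball ≃ₜ Ball) : Continuous fun q : I × Ball => alexander l q.1 q.2 :=
    (continuous_alexander l).comp ((continuous_subtype_val.comp continuous_fst).prodMk
      (continuous_subtype_val.comp continuous_snd))
  have hm {l : Ball ≃ₜ Ball} (hl : ∀ p ∈ sphere, l p = p) (t : I) (p : Ball) :
      alexander l t p ∈ Metric.closedBall (0 : Space) 1 :=
    mem_closedBall_zero_iff.2 (norm_alexander_le hl t.2.1 t.2.2 (mem_closedBall_zero_iff.1 p.2))
  refine ⟨fun t =>
    { toFun := fun p => ⟨alexander k.1 t p, hm hk t p⟩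
      invFun := fun p => ⟨alexander k.1.symm t p, hm hk' t p⟩
      left_inv := fun p => Subtype.ext
        (alexander_alexander hk hk' k.1.symm_apply_apply t.2.1 p)
      right_inv := fun p => Subtype.ext
        (alexander_alexander hk' hk k.1.apply_symm_apply t.2.1 p)
      continuous_toFun := ((hc k.1).comp (Continuous.prodMk_right t)).subtype_mk _
      continuous_invFun := ((hc k.1.symm).comp (Continuous.prodMk_right t)).subtype_mk _ },
    (hc k.1).subtype_mk _, ?_, ?_, ?_⟩
  · ext p : 1
    exact Subtype.ext (alexander_of_le hk le_rfl (norm_nonneg _))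
  · intro t p hp
    exact Subtype.ext (alexander_of_le hk t.2.1 (t.2.2.trans_eq hp.symm))
  · refine Set.image_congr fun p _ => Subtype.ext ?_
    have := alexander_smul k.1 one_pos p
    rwa [one_smul, one_smul] at this

theorem smul_eq_self_of_eqOn_sphere {k : Motion} (hk : ∀ p ∈ sphere, k.1 p = p) (τ : Tangle) :
    k • τ = τ := by
  induction τ using Quotient.inductionOn with
  | h υ => exact (Quotient.sound (isotopic_smul_of_eqOn_sphere k hk υ)).symm

/-- The action of a motion on tangles depends only on its restriction to the sphere. -/
theorem smul_eq_smul_of_eqOn_sphere {g h : Motion} (hgh : ∀ p ∈ sphere, g.1 p = h.1 p)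
    (τ : Tangle) : g • τ = h • τ := by
  rw [← inv_smul_eq_iff, smul_smul]
  refine smul_eq_self_of_eqOn_sphere (fun p hp => ?_) τ
  change h.1.symm (g.1 p) = p
  rw [hgh p hp, Homeomorph.symm_apply_apply]

/-! ### Isotopies relative to the corners -/

/-- The motion `h` is isotopic to the identity through homeomorphisms of the ball that preserve the
sphere and fix the four corners. Unlike in `Isotopic`, the other points of the sphere may move. -/
def IsotopicToOne (h : Motion) : Prop :=
  ∃ F : I → (Ball ≃ₜ Ball), Continuous (fun q : I × Ball => F q.1 q.2) ∧ F 0 = h.1 ∧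
    F 1 = Homeomorph.refl Ball ∧ (∀ t p, F t p ∈ sphere ↔ p ∈ sphere) ∧
    ∀ t, ∀ p ∈ corners, F t p = p

theorem IsotopicToOne.conj {h : Motion} (hh : IsotopicToOne h) (g : Motion) :
    IsotopicToOne (g⁻¹ * h * g) := by
  obtain ⟨F, hF, h0, h1, hs, hc⟩ := hh
  have gs (p) : g.1.symm p ∈ sphere ↔ p ∈ sphere := (g⁻¹.2 p).1
  refine ⟨fun t => (g.1.trans (F t)).trans g.1.symm, ?_, ?_, ?_, ?_, ?_⟩
  · exact g.1.symm.continuous.comp (hF.comp (continuous_fst.prodMk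
      (g.1.continuous.comp continuous_snd)))
  · simp only [h0]
    rfl
  · ext p : 1
    simp [h1]
  · intro t p
    exact (gs _).trans ((hs t _).trans (g.2 p).1)
  · intro t p hp
    have := hc t (g.1 p) ((g.2 p).2.2 hp)
    simp [this]

theorem corner_mem_sphere {p : Ball} (hp : p ∈ corners) : p ∈ sphere := by
  have h := norm_eq_of_zero hp.2.2
  rw [hp.1, hp.2.1] at h
  exact (pow_eq_one_iff_of_nonneg (norm_nonneg _) two_ne_zero).1 (by linarith)

/-- The time of the isotopy at the distance `r` from the centre: it is `1` for `r ≤ 3/4`, and `0` on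
the sphere. -/
def collarTime (r : ℝ) : I := Set.projIcc 0 1 zero_le_one (4 - 4 * r)

theorem collarTime_of_le {r : ℝ} (hr : r ≤ 3 / 4) : collarTime r = 1 :=
  Set.projIcc_of_right_le _ (by linarith)

theorem collarTime_one : collarTime 1 = 0 := Set.projIcc_of_le_left _ (by norm_num)

/-- The point `p` of the ball, divided by its distance to the centre, or by `1/2` if this is
greater. -/
def direction (p : Ball) : Ball :=
  ⟨(max (1 / 2) ‖(p : Space)‖)⁻¹ • (p : Space), by
    have h : 0 < max (1 / 2) ‖(p : Space)‖ := lt_max_of_lt_left (by norm_num)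
    rw [mem_closedBall_zero_iff, norm_smul, norm_inv, Real.norm_of_nonneg h.le, inv_mul_le_one₀ h]
    exact le_max_right _ _⟩

/-- The isotopy `F` of the sphere, spread out over the collar `3/4 ≤ ‖p‖ ≤ 1`. Where `direction p` is
not on the sphere, `F` is at its final time. -/
def collar (F : I → (Ball ≃ₜ Ball)) (p : Ball) : Space :=
  max (1 / 2) ‖(p : Space)‖ • (F (collarTime ‖(p : Space)‖) (direction p) : Space)

theorem max_smul_direction (p : Ball) : max (1 / 2) ‖(p : Space)‖ • (direction p : Space) = p :=
  smul_inv_smul₀ (lt_max_of_lt_left (by norm_num)).ne' _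

theorem direction_mem_sphere {p : Ball} (hp : 1 / 2 ≤ ‖(p : Space)‖) : direction p ∈ sphere := by
  change ‖(max (1 / 2) ‖(p : Space)‖)⁻¹ • (p : Space)‖ = 1
  rw [max_eq_right hp, norm_smul, norm_inv, norm_norm, inv_mul_cancel₀ (by linarith)]

theorem collar_of_le {F : I → (Ball ≃ₜ Ball)} (h1 : F 1 = Homeomorph.refl Ball) {p : Ball}
    (hp : ‖(p : Space)‖ ≤ 3 / 4) : collar F p = p := by
  rw [collar, collarTime_of_le hp, h1]
  exact max_smul_direction p

theorem norm_collar {F : I → (Ball ≃ₜ Ball)} (h1 : F 1 = Homeomorph.refl Ball)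
    (hs : ∀ t p, F t p ∈ sphere ↔ p ∈ sphere) (p : Ball) : ‖collar F p‖ = ‖(p : Space)‖ := by
  rcases le_total ‖(p : Space)‖ (3 / 4) with h | h
  · rw [collar_of_le h1 h]
  · have h2 : 1 / 2 ≤ ‖(p : Space)‖ := by linarith
    have h3 : ‖(F (collarTime ‖(p : Space)‖) (direction p) : Space)‖ = 1 :=
      (hs _ _).2 (direction_mem_sphere h2)
    rw [collar, norm_smul, h3, mul_one, max_eq_right h2, norm_norm]

theorem collar_collar {F G : I → (Ball ≃ₜ Ball)} (hGF : ∀ t p, G t (F t p) = p) {p q : Ball}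
    (hq : (q : Space) = collar F p) (hn : ‖(q : Space)‖ = ‖(p : Space)‖) : collar G q = p := by
  have h : 0 < max (1 / 2) ‖(p : Space)‖ := lt_max_of_lt_left (by norm_num)
  have hd : direction q = F (collarTime ‖(p : Space)‖) (direction p) := by
    apply Subtype.ext
    change (max (1 / 2) ‖(q : Space)‖)⁻¹ • (q : Space) = _
    rw [hn, hq, collar, inv_smul_smul₀ h.ne']
  rw [collar, hn, hd, hGF]
  exact max_smul_direction p

theorem continuous_collar {F : I → (Ball ≃ₜ Ball)}
    (hF : Continuous fun q : I × Ball => F q.1 q.2) : Continuous (collar F) := by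
  have h : Continuous fun p : Ball => max (1 / 2) ‖(p : Space)‖ := by fun_prop
  have ht : Continuous fun p : Ball => collarTime ‖(p : Space)‖ :=
    continuous_projIcc.comp (by fun_prop)
  have hd : Continuous direction := by
    refine ((h.inv₀ fun p => ?_).smul continuous_subtype_val).subtype_mk _
    exact (lt_max_of_lt_left (by norm_num)).ne'
  exact h.smul (continuous_subtype_val.comp (hF.comp (ht.prodMk hd)))

/-- Outside of the ball of radius `3/4` the two uncrossed ropes are radial. -/
theorem direction_mem_corners {p : Ball} (hp : p ∈ untangleSet) (h : 3 / 4 < ‖(p : Space)‖) :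
    direction p ∈ corners := by
  obtain ⟨h0, h2⟩ := hp
  have hn := norm_eq_of_zero h2
  have a0 := sq_abs (p.1 0)
  have a1 := sq_abs (p.1 1)
  have e : p.1 0 ^ 2 = p.1 1 ^ 2 := by
    rcases le_total (1 / 2) |p.1 1| with k | k
    · rw [max_eq_right k] at h0
      rw [← a0, ← a1, h0]
    · rw [max_eq_left k] at h0
      nlinarith [abs_nonneg (p.1 1)]
  have hp : ‖(p : Space)‖ ≠ 0 := by linarith
  have hd (i) : (direction p).1 i = ‖(p : Space)‖⁻¹ * p.1 i := by
    change (max (1 / 2) ‖(p : Space)‖)⁻¹ * p.1 i = _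
    rw [max_eq_right (by linarith)]
  refine ⟨?_, ?_, ?_⟩ <;> rw [hd]
  · field_simp
    linarith
  · field_simp
    linarith
  · rw [h2, mul_zero]

/-- An isotopy of the sphere relative to the corners can be spread out over a collar, where the ropes
of the untangle are radial; it is then at rest on the ropes, and by the Alexander trick the untangle
is fixed. -/
theorem IsotopicToOne.smul_untangle {h : Motion} (hh : IsotopicToOne h) :
    h • untangle = untangle := by
  obtain ⟨F, hF, h0, h1, hs, hc⟩ := hh
  let G (t : I) : Ball ≃ₜ Ball := (F t).symm
  have k1 : G 1 = Homeomorph.refl Ball := by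
    simp only [G, h1]
    rfl
  have ks (t p) : G t p ∈ sphere ↔ p ∈ sphere := by
    rw [← hs t, (F t).apply_symm_apply]
  have hm {F : I → (Ball ≃ₜ Ball)} (h1 : F 1 = Homeomorph.refl Ball)
      (hs : ∀ t p, F t p ∈ sphere ↔ p ∈ sphere) (p : Ball) :
      collar F p ∈ Metric.closedBall (0 : Space) 1 := by
    rw [mem_closedBall_zero_iff, norm_collar h1 hs]
    exact mem_closedBall_zero_iff.1 p.2
  let e : Ball ≃ Ball :=
    { toFun := fun p => ⟨collar F p, hm h1 hs p⟩
      invFun := fun p => ⟨collar G p, hm k1 ks p⟩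
      left_inv := fun p => Subtype.ext
        (collar_collar (fun t => (F t).symm_apply_apply) rfl (norm_collar h1 hs p))
      right_inv := fun p => Subtype.ext
        (collar_collar (fun t => (F t).apply_symm_apply) rfl (norm_collar k1 ks p)) }
  have he : Continuous e := (continuous_collar hF).subtype_mk _
  have hes {p : Ball} (hp : p ∈ sphere) : e p = h.1 p := by
    have hp' : ‖(p : Space)‖ = 1 := hp
    have hd : direction p = p := Subtype.ext <| by
      change (max (1 / 2) ‖(p : Space)‖)⁻¹ • (p : Space) = p
      rw [hp', max_eq_right (by norm_num), inv_one, one_smul]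
    apply Subtype.ext
    change collar F p = h.1 p
    rw [collar, hd, hp', collarTime_one, h0, max_eq_right (by norm_num), one_smul]
  have heu {p : Ball} (hp : p ∈ untangleSet) : e p = p := by
    apply Subtype.ext
    change collar F p = p
    rcases le_or_gt ‖(p : Space)‖ (3 / 4) with k | k
    · exact collar_of_le h1 k
    · rw [collar, hc _ _ (direction_mem_corners hp k)]
      exact max_smul_direction p
  have hec (p : Ball) : e p ∈ sphere ↔ p ∈ sphere :=
    iff_of_eq (congrArg (· = 1) (norm_collar h1 hs p))
  let k : Motion := ⟨he.homeoOfEquivCompactToT2, fun p => ⟨hec p, by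
    change e p ∈ corners ↔ p ∈ corners
    by_cases hp : p ∈ sphere
    · rw [hes hp]
      exact (h.2 p).2
    · exact iff_of_false (fun c => hp ((hec p).1 (corner_mem_sphere c)))
        (fun c => hp (corner_mem_sphere c))⟩⟩
  rw [smul_eq_smul_of_eqOn_sphere (h := k) fun p hp => (hes hp).symm]
  refine congrArg (Quotient.mk _) (Subtype.ext ?_)
  change e '' untangleSet = untangleSet
  rw [Set.image_congr fun p hp => heu hp, Set.image_id']

/-! ### The half turns about the coordinate axes -/

/-- The half turn of space about the `x`-axis. -/
def flipXSpace : Space ≃ₜ Space where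
  toFun p := !₂[p 0, -p 1, -p 2]
  invFun p := !₂[p 0, -p 1, -p 2]
  left_inv p := by
    ext i
    fin_cases i <;> simp
  right_inv p := by
    ext i
    fin_cases i <;> simp
  continuous_toFun := by
    refine (PiLp.continuous_toLp 2 _).comp (continuous_pi fun i => ?_)
    fin_cases i <;> simp <;> fun_prop
  continuous_invFun := by
    refine (PiLp.continuous_toLp 2 _).comp (continuous_pi fun i => ?_)
    fin_cases i <;> simp <;> fun_prop

theorem norm_flipXSpace (p : Space) : ‖flipXSpace p‖ = ‖p‖ := by
  rw [EuclideanSpace.norm_eq, EuclideanSpace.norm_eq]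
  simp [flipXSpace, Fin.sum_univ_three]

/-- The half turn about the `x`-axis. -/
def flipX : Motion where
  val := restrictToBall flipXSpace norm_flipXSpace
  property p := by
    refine ⟨iff_of_eq (congrArg (· = 1) (norm_flipXSpace p.1)), ?_⟩
    change (p.1 0 ^ 2 = 1 / 2 ∧ (-p.1 1) ^ 2 = 1 / 2 ∧ -p.1 2 = 0) ↔
      (p.1 0 ^ 2 = 1 / 2 ∧ p.1 1 ^ 2 = 1 / 2 ∧ p.1 2 = 0)
    rw [neg_sq, neg_eq_zero]

/-- The half turn about the `y`-axis. -/
def flipY : Motion := turn * flipX * turn⁻¹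

theorem Motion.ext_coe {g h : Motion} (H : ∀ (p : Ball) (i : Fin 3), (g.1 p).1 i = (h.1 p).1 i) :
    g = h := by
  refine Subtype.ext (Homeomorph.ext fun p => Subtype.ext ?_)
  ext i
  exact H p i

theorem turn_mul_flipX : turn * flipX = flipY * turn := by
  rw [flipY, inv_mul_cancel_right]

theorem coe_flipY (p : Ball) : (flipY.1 p).1 = !₂[-p.1 0, p.1 1, -p.1 2] := by
  change !₂[-(-(-p.1 0)), p.1 1, -p.1 2] = _
  rw [neg_neg]

theorem turn_mul_flipY : turn * flipY = flipX * turn := by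
  refine Motion.ext_coe fun p i => ?_
  change (turnSpace (flipY.1 p).1) i = (flipXSpace (turnSpace p.1)) i
  rw [coe_flipY]
  fin_cases i <;> simp [turnSpace, flipXSpace]

theorem turn_mul_turn : turn * turn = flipX * flipY := by
  refine Motion.ext_coe fun p i => ?_
  change (turnSpace (turnSpace p.1)) i = (flipXSpace (flipY.1 p).1) i
  rw [coe_flipY]
  fin_cases i <;> simp [turnSpace, flipXSpace]

theorem twist_mul_flipY : twist * flipY = flipY * twist := by
  refine Motion.ext_coe fun p i => ?_
  change (twistSpace (flipY.1 p).1) i = (flipY.1 (twist.1 p)).1 i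
  rw [coe_flipY, coe_flipY]
  change swirl twistAngle _ i = !₂[-swirl twistAngle p.1 0, swirl twistAngle p.1 1,
    -swirl twistAngle p.1 2] i
  fin_cases i <;> simp [swirl] <;> ring

theorem twistAngle_neg (y : ℝ) : twistAngle (-y) = Real.pi - twistAngle y := by
  have : max 0 (min 1 (1 / 2 - -y)) = 1 - max 0 (min 1 (1 / 2 - y)) := by
    rcases le_total (1 / 2) y with h | h
    · rw [min_eq_left (by linarith), min_eq_right (by linarith), max_eq_right (by norm_num),
        max_eq_left (by linarith)]
      norm_num
    · rcases le_total y (-(1 / 2)) with k | k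
      · rw [min_eq_left (a := (1 : ℝ)) (b := 1 / 2 - y) (by linarith), min_eq_right (by linarith),
          max_eq_left (by linarith), max_eq_right (by norm_num)]
        norm_num
      · rw [min_eq_right (by linarith), min_eq_right (by linarith), max_eq_right (by linarith),
          max_eq_right (by linarith)]
        ring
  rw [twistAngle, twistAngle, this]
  ring

/-- The angles of the twist at the heights `y` and `-y` add up to `π`, so that the half turn about
the `x`-axis commutes with the twist up to the half turn about the `y`-axis. -/
theorem twist_mul_flipX : twist * flipX = flipX * flipY * twist := by
  refine Motion.ext_coe fun p i => ?_
  change (twistSpace (flipXSpace p.1)) i = (flipXSpace (flipY.1 (twist.1 p)).1) i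
  rw [coe_flipY]
  change swirl twistAngle !₂[p.1 0, -p.1 1, -p.1 2] i = !₂[-swirl twistAngle p.1 0,
    -swirl twistAngle p.1 1, - -swirl twistAngle p.1 2] i
  fin_cases i <;> simp [swirl, twistAngle_neg]
  ring

/-- The tangle `τ` is fixed by the half turns about the coordinate axes. -/
def FlipInvariant (τ : Tangle) : Prop := flipX • τ = τ ∧ flipY • τ = τ

theorem flipInvariant_turn (τ : Tangle) : FlipInvariant (turn • τ) ↔ FlipInvariant τ := by
  rw [FlipInvariant, FlipInvariant, smul_smul, smul_smul, ← turn_mul_flipX, ← turn_mul_flipY,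
    mul_smul, mul_smul, smul_left_cancel_iff, smul_left_cancel_iff, and_comm]

theorem flipInvariant_twist (τ : Tangle) : FlipInvariant (twist • τ) ↔ FlipInvariant τ := by
  have hy : flipY • twist • τ = twist • τ ↔ flipY • τ = τ := by
    rw [smul_smul, ← twist_mul_flipY, mul_smul, smul_left_cancel_iff]
  have hx (h : flipY • τ = τ) : flipX • twist • τ = twist • τ ↔ flipX • τ = τ := by
    rw [← smul_left_cancel_iff twist (x := flipX • τ), smul_smul twist, twist_mul_flipX, mul_smul,
      mul_smul, hy.2 h]
  rw [FlipInvariant, FlipInvariant, hy]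
  exact and_congr_left hx

theorem flipX_mem_untangleSet (p : Ball) : flipX.1 p ∈ untangleSet ↔ p ∈ untangleSet := by
  change (|p.1 0| = max (1 / 2) |-p.1 1| ∧ -p.1 2 = 0) ↔ _
  rw [abs_neg, neg_eq_zero]
  rfl

theorem flipInvariant_untangle : FlipInvariant untangle := by
  have key (g : Motion) (hg : ∀ p, g.1 p ∈ untangleSet ↔ p ∈ untangleSet) :
      g • untangle = untangle := by
    refine congrArg (Quotient.mk _) (Subtype.ext ?_)
    change g.1 '' untangleSet = untangleSet
    ext p
    rw [← g.1.preimage_symm, Set.mem_preimage, ← hg, Homeomorph.apply_symm_apply]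
  constructor
  · exact key _ flipX_mem_untangleSet
  · refine key _ fun p => ?_
    change (|(flipY.1 p).1 0| = max (1 / 2) |(flipY.1 p).1 1| ∧ (flipY.1 p).1 2 = 0) ↔ _
    rw [coe_flipY]
    change (|-p.1 0| = max (1 / 2) |p.1 1| ∧ -p.1 2 = 0) ↔ _
    rw [abs_neg, neg_eq_zero]
    rfl

theorem flipInvariant_tangleAction (W : FreeGroup Move) (τ : Tangle) :
    FlipInvariant (tangleAction W • τ) ↔ FlipInvariant τ := by
  have pure (m : Move) (τ : Tangle) : FlipInvariant (m.motion • τ) ↔ FlipInvariant τ := by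
    cases m
    · exact flipInvariant_twist τ
    · exact flipInvariant_turn τ
  induction W using FreeGroup.induction_on generalizing τ with
  | C1 => rw [map_one, one_smul]
  | of m => simpa [tangleAction] using pure m τ
  | inv_of m _ =>
    have := pure m (m.motion⁻¹ • τ)
    rw [smul_inv_smul] at this
    simpa [tangleAction] using this.symm
  | mul V W hV hW =>
      rw [map_mul, mul_smul]
      exact (hV _).trans (hW τ)

theorem FlipInvariant.turn_turn {τ : Tangle} (h : FlipInvariant τ) : turn • turn • τ = τ := by
  rw [smul_smul, turn_mul_turn, mul_smul, h.2, h.1]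

/-! ### The tetrahedral rotation -/

theorem norm_swirl (φ : ℝ → ℝ) (p : Space) : ‖swirl φ p‖ = ‖p‖ := by
  have h := Real.sin_sq_add_cos_sq (φ (p 1))
  rw [EuclideanSpace.norm_eq, EuclideanSpace.norm_eq]
  congr 1
  simp [swirl, Fin.sum_univ_three]
  linear_combination (p 0 ^ 2 + p 2 ^ 2) * h

theorem swirl_swirl_neg (φ : ℝ → ℝ) (p : Space) : swirl φ (swirl (fun y => -φ y) p) = p := by
  simpa using swirl_neg_swirl (fun y => -φ y) p

/-- The swirl as a homeomorphism of space. -/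
def swirlHomeo (φ : ℝ → ℝ) (hφ : Continuous φ) : Space ≃ₜ Space where
  toFun := swirl φ
  invFun := swirl fun y => -φ y
  left_inv := swirl_neg_swirl φ
  right_inv := swirl_swirl_neg φ
  continuous_toFun := continuous_swirl hφ
  continuous_invFun := continuous_swirl hφ.neg

/-- The norm preserving map of space that agrees with the linear isomorphism `L` on rays. -/
def radial (L : Space ≃ₗ[ℝ] Space) (p : Space) : Space := (‖p‖ / ‖L p‖) • L p

theorem norm_radial (L : Space ≃ₗ[ℝ] Space) (p : Space) : ‖radial L p‖ = ‖p‖ := by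
  by_cases hp : p = 0
  · simp [radial, hp]
  · have : ‖L p‖ ≠ 0 := by simpa using hp
    rw [radial, norm_smul, Real.norm_of_nonneg (by positivity), div_mul_cancel₀ _ this]

theorem radial_radial (L M : Space ≃ₗ[ℝ] Space) (p : Space) :
    radial M (radial L p) = radial (L.trans M) p := by
  by_cases hp : p = 0
  · simp [radial, hp]
  · have h1 : ‖L p‖ ≠ 0 := by simpa using hp
    have h2 : ‖M (L p)‖ ≠ 0 := by simpa using hp
    have h3 : ‖p‖ ≠ 0 := by simpa using hp
    rw [radial, norm_radial, radial, map_smul, norm_smul, Real.norm_of_nonneg (by positivity),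
      smul_smul, radial, LinearEquiv.trans_apply]
    congr 1
    field_simp

theorem radial_eq_of_smul {L : Space ≃ₗ[ℝ] Space} {p q : Space} {r : ℝ} (hr : 0 < r)
    (h : L p = r • q) (hq : ‖q‖ = ‖p‖) : radial L p = q := by
  by_cases hp : p = 0
  · subst hp
    rw [norm_zero, norm_eq_zero] at hq
    simp [radial, hq]
  · have h3 : ‖p‖ ≠ 0 := by simpa using hp
    have e : ‖p‖ / (r * ‖p‖) * r = 1 := by field_simp
    rw [radial, h, norm_smul, hq, Real.norm_of_nonneg hr.le, smul_smul, e, one_smul]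

theorem radial_symm_radial (L : Space ≃ₗ[ℝ] Space) (p : Space) :
    radial L.symm (radial L p) = p := by
  rw [radial_radial]
  exact radial_eq_of_smul one_pos (by simp) rfl

theorem continuous_radial {Z : Type*} [TopologicalSpace Z] {L : Z → Space ≃ₗ[ℝ] Space}
    {f : Z → Space} (hf : Continuous f) (hL : Continuous fun z => L z (f z)) :
    Continuous fun z => radial (L z) (f z) := by
  refine continuous_iff_continuousAt.2 fun z => ?_
  by_cases hz : f z = 0
  · rw [ContinuousAt, hz]
    have : radial (L z) 0 = 0 := by simp [radial]
    rw [this]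
    refine squeeze_zero_norm (fun w => (norm_radial (L w) (f w)).le) ?_
    simpa [hz] using hf.norm.tendsto z
  · have : ‖L z (f z)‖ ≠ 0 := by simpa using hz
    exact (hf.norm.continuousAt.div hL.norm.continuousAt this).smul hL.continuousAt

/-- The map `radial L` as a homeomorphism. -/
def radialHomeo (L : Space ≃ₗ[ℝ] Space) : Space ≃ₜ Space where
  toFun := radial L
  invFun := radial L.symm
  left_inv := radial_symm_radial L
  right_inv := radial_symm_radial L.symm
  continuous_toFun := continuous_radial continuous_id L.toLinearMap.continuous_of_finiteDimensional
  continuous_invFun :=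
    continuous_radial continuous_id L.symm.toLinearMap.continuous_of_finiteDimensional

/-- A path of linear isomorphisms from the quarter turn about the `z`-axis, for `t = 0`, to `2` times
an isomorphism of order three, for `t = 1`. If the bottom corners `1` and `2` are rotated about the
`y`-axis by the angle `π - 2 arctan t`, the image of the four corners under `tetra t` is, up to the
factor `1 + t ^ 2`, the set of corners with the bottom ones rotated by `2 arctan t`; for `t = 1`, both
are the vertices of the same tetrahedron. -/
def tetra (t : ℝ) : Space ≃ₗ[ℝ] Space where
  toFun p := !₂[-t ^ 2 * p 0 - p 1 + t * p 2, (1 + t ^ 2) * (p 0 + t * p 2),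
    -t * p 0 + t * p 1 + p 2]
  invFun p := !₂[(p 1 - t ^ 2 * p 0 - t * p 2) / (1 + t ^ 2) ^ 2, (t * p 2 - p 0) / (1 + t ^ 2),
    (t * p 0 + t * p 1 + p 2) / (1 + t ^ 2) ^ 2]
  map_add' p q := by
    ext i
    fin_cases i <;> simp <;> ring
  map_smul' r p := by
    ext i
    fin_cases i <;> simp <;> ring
  left_inv p := by
    have : 1 + t ^ 2 ≠ 0 := by positivity
    ext i
    fin_cases i <;> simp <;> field_simp <;> ring
  right_inv p := by
    have : 1 + t ^ 2 ≠ 0 := by positivity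
    ext i
    fin_cases i <;> simp <;> field_simp <;> ring

theorem tetra_apply (t : ℝ) (p : Space) : tetra t p = !₂[-t ^ 2 * p 0 - p 1 + t * p 2,
    (1 + t ^ 2) * (p 0 + t * p 2), -t * p 0 + t * p 1 + p 2] := rfl

theorem radial_tetra_zero (p : Space) : radial (tetra 0) p = turnSpace p := by
  refine radial_eq_of_smul one_pos ?_ (norm_turnSpace p)
  ext i
  fin_cases i <;> simp [tetra_apply, turnSpace]

theorem radial_tetra_one (p : Space) :
    radial (tetra 1) (radial (tetra 1) (radial (tetra 1) p)) = p := by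
  rw [radial_radial, radial_radial]
  refine radial_eq_of_smul (r := 8) (by norm_num) ?_ rfl
  ext i
  fin_cases i <;> simp [tetra_apply] <;> ring

/-- The fraction of the twist that rotates the bottom corners by `2 arctan t`. -/
def twistFraction (t : ℝ) : ℝ := 2 * Real.arctan t / Real.pi

theorem twistFraction_zero : twistFraction 0 = 0 := by simp [twistFraction]

theorem twistFraction_one : twistFraction 1 = 1 / 2 := by
  rw [twistFraction, Real.arctan_one]
  field_simp
  norm_num

theorem continuous_twistFraction : Continuous twistFraction := by
  unfold twistFraction
  exact (continuous_const.mul Real.continuous_arctan).div_const _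

theorem cos_two_mul_arctan (t : ℝ) : Real.cos (2 * Real.arctan t) = (1 - t ^ 2) / (1 + t ^ 2) := by
  have : 1 + t ^ 2 ≠ 0 := by positivity
  rw [Real.cos_two_mul, Real.cos_sq_arctan]
  field_simp
  ring

theorem sin_two_mul_arctan (t : ℝ) : Real.sin (2 * Real.arctan t) = 2 * t / (1 + t ^ 2) := by
  have h : Real.sin (Real.arctan t) = t * Real.cos (Real.arctan t) := by
    nth_rw 2 [← Real.tan_arctan t]
    rw [Real.tan_mul_cos (Real.cos_arctan_pos t).ne']
  rw [Real.sin_two_mul, h]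
  have := Real.cos_sq_arctan t
  calc 2 * (t * Real.cos (Real.arctan t)) * Real.cos (Real.arctan t)
      = 2 * t * Real.cos (Real.arctan t) ^ 2 := by ring
    _ = _ := by rw [this]; ring

theorem twistAngle_of_pos {y : ℝ} (hy : y ^ 2 = 1 / 2) (h : 0 < y) : twistAngle y = 0 := by
  have : 1 / 2 - y ≤ 0 := by nlinarith
  rw [twistAngle, min_eq_right (this.trans zero_le_one), max_eq_left this, mul_zero]

theorem twistAngle_of_neg {y : ℝ} (hy : y ^ 2 = 1 / 2) (h : y < 0) : twistAngle y = Real.pi := by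
  have : 1 ≤ 1 / 2 - y := by nlinarith
  rw [twistAngle, min_eq_left this, max_eq_right zero_le_one, mul_one]

theorem tetra_swirl_corner (t : ℝ) {p : Space} (h0 : p 0 ^ 2 = 1 / 2) (h1 : p 1 ^ 2 = 1 / 2)
    (h2 : p 2 = 0) :
    tetra t (swirl (fun y => (1 - twistFraction t) * twistAngle y) p) =
      (1 + t ^ 2) • swirl (fun y => twistFraction t * twistAngle y)
        (turnSpace (swirl twistAngle p)) := by
  have hm : 1 + t ^ 2 ≠ 0 := by positivity
  have ea : twistFraction t * Real.pi = 2 * Real.arctan t := by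
    rw [twistFraction]
    field_simp
  have eb : (1 - twistFraction t) * Real.pi = Real.pi - 2 * Real.arctan t := by
    rw [sub_mul, ea, one_mul]
  have hx : p 0 = p 1 ∨ p 0 = -p 1 := sq_eq_sq_iff_eq_or_eq_neg.1 (h0.trans h1.symm)
  have hy : p 1 ≠ 0 := by
    intro h
    norm_num [h] at h1
  have h1' : (-p 1) ^ 2 = 1 / 2 := by rwa [neg_sq]
  rcases lt_or_gt_of_ne hy with h | h
  · have e := twistAngle_of_neg h1 h
    have e' := twistAngle_of_pos h1' (neg_pos.2 h)
    rcases hx with hx | hx <;> ext i <;> fin_cases i <;>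
      simp [tetra_apply, swirl, turnSpace, hx, h2, e, e', ea, eb, cos_two_mul_arctan,
        sin_two_mul_arctan, hm] <;> field_simp <;> ring
  · have e := twistAngle_of_pos h1 h
    have e' := twistAngle_of_neg h1' (neg_lt_zero.2 h)
    rcases hx with hx | hx <;> ext i <;> fin_cases i <;>
      simp [tetra_apply, swirl, turnSpace, hx, h2, e, e', ea, cos_two_mul_arctan,
        sin_two_mul_arctan] <;> field_simp <;> ring

/-- A path of norm preserving homeomorphisms of space, constant on the corners, from the composite of
twist and turn, for `t = 0`, to a homeomorphism of order three, for `t = 1`. The final homeomorphism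
is `radial (tetra 1)`, conjugated by half a twist. -/
def tetraHomeo (t : ℝ) : Space ≃ₜ Space :=
  ((swirlHomeo (fun y => (1 - twistFraction t) * twistAngle y)
    (continuous_const.mul continuous_twistAngle)).trans (radialHomeo (tetra t))).trans
    (swirlHomeo (fun y => -(twistFraction t * twistAngle y))
      (continuous_const.mul continuous_twistAngle).neg)

theorem tetraHomeo_apply (t : ℝ) (p : Space) :
    tetraHomeo t p = swirl (fun y => -(twistFraction t * twistAngle y))
      (radial (tetra t) (swirl (fun y => (1 - twistFraction t) * twistAngle y) p)) := rfl

theorem norm_tetraHomeo (t : ℝ) (p : Space) : ‖tetraHomeo t p‖ = ‖p‖ := by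
  rw [tetraHomeo_apply, norm_swirl, norm_radial, norm_swirl]

theorem tetraHomeo_zero (p : Space) : tetraHomeo 0 p = turnSpace (twistSpace p) := by
  rw [tetraHomeo_apply, radial_tetra_zero, twistFraction_zero]
  simp only [zero_mul, sub_zero, one_mul, neg_zero]
  change swirl (fun _ => 0) (turnSpace (swirl twistAngle p)) = turnSpace (swirl twistAngle p)
  generalize turnSpace (swirl twistAngle p) = q
  ext i
  fin_cases i <;> simp [swirl]

theorem tetraHomeo_one (p : Space) : tetraHomeo 1 (tetraHomeo 1 (tetraHomeo 1 p)) = p := by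
  have e : (1 : ℝ) - 1 / 2 = 1 / 2 := by norm_num
  simp only [tetraHomeo_apply, twistFraction_one, e, swirl_swirl_neg, radial_tetra_one,
    swirl_neg_swirl]

theorem tetraHomeo_corner (t : ℝ) {p : Space} (h0 : p 0 ^ 2 = 1 / 2) (h1 : p 1 ^ 2 = 1 / 2)
    (h2 : p 2 = 0) : tetraHomeo t p = turnSpace (twistSpace p) := by
  rw [tetraHomeo_apply, radial_eq_of_smul (by positivity) (tetra_swirl_corner t h0 h1 h2),
    swirl_neg_swirl]
  · rfl
  · rw [norm_swirl, norm_turnSpace, norm_swirl, norm_swirl]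

theorem continuous_swirl_family {Z : Type*} [TopologicalSpace Z] {φ : Z → ℝ → ℝ} {f : Z → Space}
    (hf : Continuous f) (hφ : Continuous fun q : Z × ℝ => φ q.1 q.2) :
    Continuous fun z => swirl (φ z) (f z) := by
  have h (i : Fin 3) : Continuous fun z => f z i := by fun_prop
  have hc : Continuous fun z => φ z (f z 1) := hφ.comp (continuous_id.prodMk (h 1))
  refine (PiLp.continuous_toLp 2 _).comp (continuous_pi fun i => ?_)
  fin_cases i <;> simp <;> fun_prop

theorem continuous_tetra_family {Z : Type*} [TopologicalSpace Z] {s : Z → ℝ} {f : Z → Space}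
    (hs : Continuous s) (hf : Continuous f) : Continuous fun z => tetra (s z) (f z) := by
  have h (i : Fin 3) : Continuous fun z => f z i := by fun_prop
  simp only [tetra_apply]
  refine (PiLp.continuous_toLp 2 _).comp (continuous_pi fun i => ?_)
  fin_cases i <;> simp <;> fun_prop

theorem continuous_tetraHomeo : Continuous fun q : ℝ × Space => tetraHomeo q.1 q.2 := by
  have ha : Continuous fun q : (ℝ × Space) × ℝ => twistFraction q.1.1 :=
    continuous_twistFraction.comp (by fun_prop)
  have hb : Continuous fun q : (ℝ × Space) × ℝ => twistAngle q.2 :=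
    continuous_twistAngle.comp continuous_snd
  have h1 : Continuous fun q : (ℝ × Space) × ℝ => (1 - twistFraction q.1.1) * twistAngle q.2 :=
    (continuous_const.sub ha).mul hb
  have h2 : Continuous fun q : (ℝ × Space) × ℝ => -(twistFraction q.1.1 * twistAngle q.2) :=
    (ha.mul hb).neg
  have h3 := continuous_swirl_family
    (φ := fun (q : ℝ × Space) y => (1 - twistFraction q.1) * twistAngle y) continuous_snd h1
  have h4 := continuous_radial h3 (continuous_tetra_family continuous_fst h3)
  exact continuous_swirl_family
    (φ := fun (q : ℝ × Space) y => -(twistFraction q.1 * twistAngle y)) h4 h2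

theorem IsotopicToOne.pow_three {h : Motion} (J : I → (Ball ≃ₜ Ball))
    (hJ : Continuous fun q : I × Ball => J q.1 q.2) (h0 : J 0 = h.1)
    (h1 : ∀ p, J 1 (J 1 (J 1 p)) = p) (hs : ∀ t p, J t p ∈ sphere ↔ p ∈ sphere)
    (hc : ∀ t, ∀ p ∈ corners, J t p = h.1 p) : IsotopicToOne (h ^ 3) := by
  have hm {p} (hp : p ∈ corners) : h.1 p ∈ corners := (h.2 p).2.2 hp
  refine ⟨fun t => (J t).trans ((J t).trans (J t)), ?_, ?_, ?_, ?_, ?_⟩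
  · exact hJ.comp (continuous_fst.prodMk (hJ.comp (continuous_fst.prodMk hJ)))
  · simp only [h0]
    rfl
  · ext p : 1
    exact h1 p
  · exact fun t p => (hs t _).trans ((hs t _).trans (hs t p))
  · intro t p hp
    change J t (J t (J t p)) = p
    conv_rhs => rw [← h1 p]
    rw [hc t p hp, hc t _ (hm hp), hc t _ (hm (hm hp)), hc 1 p hp, hc 1 _ (hm hp),
      hc 1 _ (hm (hm hp))]

/-- The relation `(R T)³ = 1`, up to isotopy relative to the corners. -/
theorem isotopicToOne_turn_mul_twist : IsotopicToOne ((turn * twist) ^ 3) := by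
  have hJ : Continuous fun q : I × Ball => tetraHomeo q.1 q.2 :=
    continuous_tetraHomeo.comp (f := fun q : I × Ball => ((q.1 : ℝ), (q.2 : Space))) (by fun_prop)
  refine IsotopicToOne.pow_three
    (fun t => restrictToBall (tetraHomeo t) (norm_tetraHomeo t)) (hJ.subtype_mk _) ?_ ?_ ?_ ?_
  · ext p : 1
    exact Subtype.ext (tetraHomeo_zero p)
  · exact fun p => Subtype.ext (tetraHomeo_one p)
  · exact fun t p => iff_of_eq (congrArg (· = 1) (norm_tetraHomeo t p))
  · exact fun t p hp => Subtype.ext (tetraHomeo_corner t hp.1 hp.2.1 hp.2.2)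

/-! ### The relations on rational tangles -/

/-- Half of the turned untangle is at rest under the twist; the other half makes a half turn. -/
theorem twist_turn_of_mem {p : Ball} (hp : p ∈ untangleSet) :
    twist.1 (turn.1 p) = if p.1 0 < 0 then turn.1 (flipX.1 p) else turn.1 p := by
  obtain ⟨h0, h2⟩ := hp
  have h : 1 / 2 ≤ |p.1 0| := h0 ▸ le_max_left _ _
  split_ifs with hn
  · rw [abs_of_neg hn] at h
    have e : twistAngle (p.1 0) = Real.pi := by
      rw [twistAngle, min_eq_left (by linarith), max_eq_right zero_le_one, mul_one]
    apply Subtype.ext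
    change swirl twistAngle (turnSpace p.1) = turnSpace (flipXSpace p.1)
    ext i
    fin_cases i <;> simp [swirl, turnSpace, flipXSpace, e, h2]
  · rw [abs_of_nonneg (not_lt.1 hn)] at h
    have e : twistAngle (p.1 0) = 0 := by
      rw [twistAngle, min_eq_right (by linarith), max_eq_left (by linarith), mul_zero]
    apply Subtype.ext
    change swirl twistAngle (turnSpace p.1) = turnSpace p.1
    ext i
    fin_cases i <;> simp [swirl, turnSpace, e]

theorem twist_turn_untangle : twist • turn • untangle = turn • untangle := by
  refine congrArg (Quotient.mk _) (Subtype.ext ?_)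
  have hf {p : Ball} (hp : p ∈ untangleSet) : flipX.1 p ∈ untangleSet :=
    (flipX_mem_untangleSet p).2 hp
  have hff (p : Ball) : flipX.1 (flipX.1 p) = p := Subtype.ext (flipXSpace.left_inv p.1)
  have h {p : Ball} (hp : p ∈ untangleSet) : twist.1 (turn.1 p) = turn.1 p ∨
      ∃ q ∈ untangleSet, twist.1 (turn.1 p) = turn.1 q ∧ twist.1 (turn.1 q) = turn.1 p := by
    by_cases hn : p.1 0 < 0
    · refine Or.inr ⟨_, hf hp, (twist_turn_of_mem hp).trans (if_pos hn), ?_⟩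
      rw [twist_turn_of_mem (hf hp), hff]
      exact if_pos hn
    · exact Or.inl ((twist_turn_of_mem hp).trans (if_neg hn))
  change twist.1 '' (turn.1 '' untangleSet) = turn.1 '' untangleSet
  rw [Set.image_image]
  ext p
  constructor
  · rintro ⟨q, hq, rfl⟩
    rcases h hq with e | ⟨r, hr, e, -⟩
    · exact ⟨q, hq, e.symm⟩
    · exact ⟨r, hr, e.symm⟩
  · rintro ⟨q, hq, rfl⟩
    rcases h hq with e | ⟨r, hr, -, e⟩
    · exact ⟨q, hq, e⟩
    · exact ⟨r, hr, e⟩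

theorem turn_mul_twist_pow_smul (g : Motion) :
    (turn * twist) ^ 3 • g • untangle = g • untangle := by
  have := (isotopicToOne_turn_mul_twist.conj g).smul_untangle
  rwa [mul_assoc, mul_smul, inv_smul_eq_iff, mul_smul] at this

/-- The value of a word at `0` determines its effect on the untangle. -/
theorem exists_tangle_of_value : ∃ c : OnePoint ℚ → Tangle, c ((0 : ℚ) : OnePoint ℚ) = untangle ∧
    ∀ W : FreeGroup Move,
      c (valueAction W ((0 : ℚ) : OnePoint ℚ)) = tangleAction W • untangle := by
  let G := tangleAction.range
  let X := MulAction.orbit G untangle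
  let M (m : Move) : G := ⟨m.motion, FreeGroup.of m, by simp [tangleAction]⟩
  obtain ⟨c, h0, hT, hR⟩ := exists_equivariant (X := X) (T := MulAction.toPerm (M .T))
    (R := MulAction.toPerm (M .R)) (x₀ := ⟨untangle, MulAction.mem_orbit_self _⟩) (by
      rintro ⟨_, ⟨⟨_, W, rfl⟩, rfl⟩⟩
      exact Subtype.ext ((flipInvariant_tangleAction W _).2 flipInvariant_untangle).turn_turn) (by
      rintro ⟨_, ⟨⟨g, _⟩, rfl⟩⟩
      apply Subtype.ext
      have := turn_mul_twist_pow_smul g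
      simp only [pow_succ, pow_zero, one_mul, mul_smul] at this
      exact this) (Subtype.ext twist_turn_untangle)
  have hc (m : Move) (x) : (c (m.value x)).1 = m.motion • (c x).1 := by
    cases m
    · exact congrArg Subtype.val (hT x)
    · exact congrArg Subtype.val (hR x)
  have key (W : FreeGroup Move) (x) : (c (valueAction W x)).1 = tangleAction W • (c x).1 := by
    induction W using FreeGroup.induction_on generalizing x with
    | C1 => simp
    | of m => simpa [tangleAction, valueAction] using hc m x
    | inv_of m _ =>
      have := hc m (m.value⁻¹ x)
      rw [show m.value (m.value⁻¹ x) = x from m.value.apply_symm_apply x] at this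
      simp [tangleAction, valueAction, this]
    | mul V W hV hW =>
      rw [map_mul, map_mul, Equiv.Perm.mul_apply, mul_smul]
      exact (hV _).trans (congrArg _ (hW x))
  refine ⟨fun x => (c x).1, congrArg Subtype.val h0, fun W => ?_⟩
  change (c _).1 = _
  rw [key W, h0]

theorem perform_eq (w : List Move) :
    perform w = tangleAction (w.map FreeGroup.of).prod • untangle := by
  induction w with
  | nil => simp [perform]
  | cons m w ih => simp [perform, ih, mul_smul, tangleAction]

theorem invariant_eq (w : List Move) :
    invariant w = valueAction (w.map FreeGroup.of).prod ((0 : ℚ) : OnePoint ℚ) := by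
  induction w with
  | nil => simp [invariant]
  | cons m w ih => simp [invariant, ih, valueAction]

end TangleTrick

end

/-- A rational tangle that has invariant `0` is the untangle; moreover, in the free group on the
letters `T` and `R`, the stabilizer of `0 ∈ ℚ ∪ {∞}` fixes the untangle. -/
theorem proposition3p1 :
    (∀ τ : TangleTrick.RationalTangle, τ.HasInvariant ((0 : ℚ) : OnePoint ℚ) →
      τ.1 = TangleTrick.untangle) ∧
    (∀ W : FreeGroup TangleTrick.Move,
      TangleTrick.valueAction W ((0 : ℚ) : OnePoint ℚ) = ((0 : ℚ) : OnePoint ℚ) →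
      TangleTrick.tangleAction W • TangleTrick.untangle = TangleTrick.untangle) := by
  obtain ⟨c, h0, hc⟩ := TangleTrick.exists_tangle_of_value
  have key (W : FreeGroup TangleTrick.Move)
      (hW : TangleTrick.valueAction W ((0 : ℚ) : OnePoint ℚ) = ((0 : ℚ) : OnePoint ℚ)) :
      TangleTrick.tangleAction W • TangleTrick.untangle = TangleTrick.untangle := by
    rw [← hc, hW, h0]
  refine ⟨?_, key⟩
  rintro τ ⟨w, hw, hx⟩
  rw [← hw, TangleTrick.perform_eq]
  exact key _ (by rw [← TangleTrick.invariant_eq, hx])
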